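/- Let $K$ be a field and $S=K[x_1,\dots,x_n]$ with graded maximal ideal $\mathfrak m=(x_1,\dots,x_n)$. For a non-empty subset $F\subseteq\{1,\dots,n\}$ let $\mathfrak p_F=(x_i : i\in F)\subset S$; the ideals of this form are called monomial prime ideals. For an ideal $I\subsetneq S$ let $\operatorname{depth} S/I$ be the supremum of the lengths of $S/I$-regular sequences with entries in $\mathfrak m$, and let $\operatorname{mdepth} S/I=\min\{\dim S/\mathfrak p : \mathfrak p\in\operatorname{Ass}(S/I)\}$; one says that $I$ has maximal depth if $\operatorname{depth} S/I=\operatorname{mdepth} S/I$. Let $r\ge 1$, let $F_1,\dots,F_r$ be non-empty, pairwise disjoint subsets of $\{1,\dots,n\}$, and let $I=\mathfrak p_{F_1}\cap\dots\cap\mathfrak p_{F_r}$. Then $I$ has maximal depth if and only if there are $s\ge 1$ and non-empty subsets $G_1,\dots,G_s\subseteq\{1,\dots,n\}$ (not assumed to be disjoint or distinct) such that $I=\mathfrak p_{G_1}\cdots\mathfrak p_{G_s}$ and at most one of the factors $\mathfrak p_{G_1},\dots,\mathfrak p_{G_s}$ is not a principal ideal. -/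

import Mathlib

noncomputable section

/-- The depth of an `R`-module `M` with respect to an ideal `J`: the supremum of the lengths of
`M`-regular sequences with entries in `J`. For a standard graded algebra `R` with graded maximal
ideal `J` and a finitely generated module `M`, this is the usual `depth M`. -/
def moduleDepth {R : Type*} [CommRing R] (J : Ideal R)
    (M : Type*) [AddCommGroup M] [Module R M] : ℕ∞ :=
  ⨆ rs ∈ {rs : List R | (∀ x ∈ rs, x ∈ J) ∧ RingTheory.Sequence.IsRegular M rs},
    (rs.length : ℕ∞)

/-- `mdepth M`: the minimum of `dim R/p` over the associated primes `p` of `M`. -/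
def moduleMDepth (R : Type*) [CommRing R]
    (M : Type*) [AddCommGroup M] [Module R M] : WithBot ℕ∞ :=
  ⨅ p ∈ associatedPrimes R M, ringKrullDim (R ⧸ p)

/-- An ideal `I` of `S = K[x_1, …, x_n]` has maximal depth if `depth S/I = mdepth S/I`,
where the depth is taken with respect to the graded maximal ideal `(x_1, …, x_n)`. -/
def HasMaximalDepth {K : Type*} [Field K] {n : ℕ} (I : Ideal (MvPolynomial (Fin n) K)) : Prop :=
  (moduleDepth (MvPolynomial.idealOfVars (Fin n) K) (MvPolynomial (Fin n) K ⧸ I) : WithBot ℕ∞) =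
    moduleMDepth (MvPolynomial (Fin n) K) (MvPolynomial (Fin n) K ⧸ I)

/-- The ideal generated by the variables `x_i` with `i ∈ F`; for non-empty `F` these are the
monomial prime ideals of `K[x_1, …, x_n]`. -/
def monomialPrime (K : Type*) [Field K] {n : ℕ} (F : Finset (Fin n)) :
    Ideal (MvPolynomial (Fin n) K) :=
  Ideal.span (MvPolynomial.X '' (F : Set (Fin n)))

end

/-! Since the F_i are disjoint, I is also the product of the p_{F_i}, and both invariants can be
computed. The associated primes of S/I are exactly the p_{F_i}, so mdepth S/I = n - max |F_i|.

For the depth, pick z_i ∈ F_i, let b be one of the z_i, and let C consist of the other z_i and of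
the indices lying in no F_i. The forms x_a - x_b (a ∈ C) are a regular sequence on S/I. Modulo them
every factor contains x_b and the factors together contain every remaining variable, so x_b^(r-1) is
a nonzero socle element. Hence depth S/I = |C| = n - 1 - Σ(|F_i| - 1)
(`moduleDepth_quotient_prod_monomialPrime`).

The two numbers agree iff |F_i| = 1 for all i with at most one exception, that is, iff at most one
p_{F_i} is not principal. Conversely, each p_{F_i} is a minimal prime of I and so occurs in every
factorisation of I into monomial primes. -/

section
-- Depth as the first nonvanishing Ext
universe u
open CategoryTheory Abelian Limits

/-- `Ext^d(N, M)` is the first nonvanishing group among the `Ext^i(N, M)`. -/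
def FirstNonzeroExt {R : Type u} [CommRing R] (N M : ModuleCat.{u} R) (d : ℕ) : Prop :=
  (∀ i < d, Subsingleton (Ext N M i)) ∧ ¬ Subsingleton (Ext N M d)

variable {R : Type u} [CommRing R]

/-- The map 1 ↦ u is a well-defined nonzero element of Hom(R/J, R/I). -/
theorem firstNonzeroExt_zero_of_socle {I J : Ideal R} {u : R} (hu : u ∉ I)
    (hJ : ∀ x ∈ J, x * u ∈ I) :
    FirstNonzeroExt (ModuleCat.of R (R ⧸ J)) (ModuleCat.of R (R ⧸ I)) 0 := by
  refine ⟨by simp, fun hs => hu ?_⟩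
  have h1 : Subsingleton ((R ⧸ J) →ₗ[R] (R ⧸ I)) :=
    (Ext.addEquiv₀.trans ModuleCat.homAddEquiv : Ext (ModuleCat.of R (R ⧸ J))
      (ModuleCat.of R (R ⧸ I)) 0 ≃+ ((R ⧸ J) →ₗ[R] (R ⧸ I))).symm.subsingleton
  let f : (R ⧸ J) →ₗ[R] (R ⧸ I) :=
    Submodule.liftQ J (LinearMap.toSpanSingleton R (R ⧸ I) (Ideal.Quotient.mk I u)) (by
      intro x hx
      simp only [LinearMap.mem_ker, LinearMap.toSpanSingleton_apply]
      rw [← Ideal.Quotient.mk_eq_mk, ← Submodule.Quotient.mk_smul]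
      exact (Submodule.Quotient.mk_eq_zero _).2 (hJ x hx))
  have h2 : f (Submodule.Quotient.mk 1) = 0 := by rw [Subsingleton.elim f 0]; rfl
  have h3 : f (Submodule.Quotient.mk 1) = Ideal.Quotient.mk I u :=
    (Submodule.liftQ_apply _ _ _).trans (one_smul R _)
  rw [h3] at h2
  exact Ideal.Quotient.eq_zero_iff_mem.1 h2

/-- As r kills N, it acts as zero on Ext^i(N, M). For i ≤ d it also acts injectively, by the long
exact sequence, so these groups vanish; then Ext^d(N, Q) embeds in Ext^(d+1)(N, M). -/
theorem firstNonzeroExt_succ {N M Q : ModuleCat.{u} R} {r : R}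
    (hN : r ∈ Module.annihilator R N) (g : M ⟶ Q) (w : (r • 𝟙 M) ≫ g = 0)
    (hS : (ShortComplex.mk (r • 𝟙 M) g w).ShortExact) {d : ℕ} (h : FirstNonzeroExt N Q d) :
    FirstNonzeroExt N M (d + 1) := by
  have hvan : ∀ i < d + 1, Subsingleton (Ext N M i) := by
    intro i hi
    have hzero : AddCommGrpCat.ofHom ((Ext.mk₀ (r • 𝟙 M)).postcomp N (add_zero i)) = 0 :=
      Ext.postcomp_smul_id_eq_zero_of_mem_annihilator hN i
    have hmono : Mono (AddCommGrpCat.ofHom ((Ext.mk₀ (r • 𝟙 M)).postcomp N (add_zero i))) := by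
      cases i with
      | zero =>
        have := hS.mono_f
        exact Ext.mono_postcomp_mk₀_of_mono N (r • 𝟙 M)
      | succ j =>
        exact (Ext.covariant_sequence_exact₁' N hS j (j + 1) rfl).mono_g
          ((AddCommGrpCat.isZero_of_iff_subsingleton.mpr (h.1 j (by omega))).eq_zero_of_src _)
    exact AddCommGrpCat.subsingleton_of_isZero (IsZero.of_mono_eq_zero _ hzero)
  refine ⟨hvan, fun hs => h.2 ?_⟩
  have zero1 := AddCommGrpCat.isZero_of_iff_subsingleton.mpr (hvan d (by omega))
  have zero2 := AddCommGrpCat.isZero_of_iff_subsingleton.mpr hs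
  exact AddCommGrpCat.subsingleton_of_isZero <| ShortComplex.Exact.isZero_of_both_zeros
    (Ext.covariant_sequence_exact₃' N hS d (d + 1) rfl)
    (zero1.eq_zero_of_src _) (zero2.eq_zero_of_tgt _)

theorem firstNonzeroExt_quotient_succ {I J : Ideal R} {h : R} (hJ : h ∈ J)
    (hreg : ∀ u, h * u ∈ I → u ∈ I) {d : ℕ}
    (hd : FirstNonzeroExt (ModuleCat.of R (R ⧸ J))
      (ModuleCat.of R (R ⧸ (I ⊔ Ideal.span {h}))) d) :
    FirstNonzeroExt (ModuleCat.of R (R ⧸ J)) (ModuleCat.of R (R ⧸ I)) (d + 1) := by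
  have hle : I ≤ I ⊔ Ideal.span {h} := le_sup_left
  let g : ModuleCat.of R (R ⧸ I) ⟶ ModuleCat.of R (R ⧸ (I ⊔ Ideal.span {h})) :=
    ModuleCat.ofHom (Submodule.factor hle)
  have hann : h ∈ Module.annihilator R (ModuleCat.of R (R ⧸ J)) := by
    change h ∈ Module.annihilator R (R ⧸ J)
    rwa [Ideal.annihilator_quotient]
  have key : ∀ u : R, (h • 𝟙 (ModuleCat.of R (R ⧸ I))).hom (Submodule.Quotient.mk u) =
      Submodule.Quotient.mk (h * u) := fun u => rfl
  have w : (h • 𝟙 (ModuleCat.of R (R ⧸ I))) ≫ g = 0 := by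
    refine ModuleCat.hom_ext (LinearMap.ext fun x => ?_)
    obtain ⟨u, rfl⟩ := Submodule.Quotient.mk_surjective _ x
    change (Submodule.Quotient.mk (h * u) : R ⧸ (I ⊔ Ideal.span {h})) = 0
    exact (Submodule.Quotient.mk_eq_zero _).2 (Ideal.mem_sup_right
      (Ideal.mul_mem_right _ _ (Ideal.mem_span_singleton_self h)))
  refine firstNonzeroExt_succ hann g w { exact := ?_, mono_f := ?_, epi_g := ?_ } hd
  · rw [ShortComplex.moduleCat_exact_iff]
    intro x hx
    obtain ⟨u, rfl⟩ := Submodule.Quotient.mk_surjective _ x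
    have hu : u ∈ I ⊔ Ideal.span {h} := (Submodule.Quotient.mk_eq_zero _).1 hx
    obtain ⟨a, ha, b, hb, rfl⟩ := Submodule.mem_sup.1 hu
    obtain ⟨c, rfl⟩ := Ideal.mem_span_singleton'.1 hb
    refine ⟨Submodule.Quotient.mk c, (key c).trans ?_⟩
    refine (Submodule.Quotient.eq _).2 ?_
    have : h * c - (a + c * h) = -a := by ring
    rw [this]
    exact I.neg_mem ha
  · refine (ModuleCat.mono_iff_injective _).2 ((injective_iff_map_eq_zero _).2 fun x hx => ?_)
    obtain ⟨u, rfl⟩ := Submodule.Quotient.mk_surjective _ x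
    exact (Submodule.Quotient.mk_eq_zero _).2
      (hreg u ((Submodule.Quotient.mk_eq_zero _).1 ((key u).symm.trans hx)))
  · exact (ModuleCat.epi_iff_surjective _).2 (Submodule.factor_surjective hle)

/-- Rees's characterisation of depth by Ext, applied with the test module R/J, whose support is
V(J). -/
theorem moduleDepth_quotient_eq [IsNoetherianRing R] {I J : Ideal R} (hIJ : I ≤ J) (hJ : J ≠ ⊤)
    {d : ℕ} (hd : FirstNonzeroExt (ModuleCat.of R (R ⧸ J)) (ModuleCat.of R (R ⧸ I)) d) :
    moduleDepth J (R ⧸ I) = d := by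
  have hnt : Nontrivial (R ⧸ J) := Ideal.Quotient.nontrivial_iff.2 hJ
  have hsupp : Module.support R (ModuleCat.of R (R ⧸ J)) = PrimeSpectrum.zeroLocus J := by
    change Module.support R (R ⧸ J) = _
    rw [Module.support_eq_zeroLocus, Ideal.annihilator_quotient]
  -- R/I surjects onto R/J, which is nonzero and killed by J.
  have hlt : J • (⊤ : Submodule R (ModuleCat.of R (R ⧸ I))) < ⊤ := by
    refine lt_top_iff_ne_top.2 fun htop => hJ ?_
    change J • (⊤ : Submodule R (R ⧸ I)) = ⊤ at htop
    have h1 := congrArg (Submodule.map (Submodule.factor hIJ)) htop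
    rw [Submodule.map_smul'', Submodule.map_top,
      LinearMap.range_eq_top.2 (Submodule.factor_surjective hIJ)] at h1
    have h2 : (J • ⊤ : Submodule R (R ⧸ J)) = ⊥ := by
      rw [← le_bot_iff, Submodule.smul_le]
      intro r hr x _
      obtain ⟨u, rfl⟩ := Submodule.Quotient.mk_surjective _ x
      exact (Submodule.Quotient.mk_eq_zero _).2 (Ideal.mul_mem_right _ _ hr)
    exact absurd (h2.symm.trans h1) bot_ne_top
  have hfin : Module.Finite R (ModuleCat.of R (R ⧸ I)) :=
    inferInstanceAs (Module.Finite R (R ⧸ I))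
  have hfin' : Module.Finite R (ModuleCat.of R (R ⧸ J)) :=
    inferInstanceAs (Module.Finite R (R ⧸ J))
  apply le_antisymm
  · refine iSup₂_le fun rs hrs => ?_
    by_contra hlen
    have hlen' : d < rs.length := by simpa using hlen
    exact hd.2 (ModuleCat.subsingleton_ext_of_exists_isRegular J _ hsupp.subset _ hlt rs hrs.1 hrs.2
      d hlen')
  · obtain ⟨rs, hl, hm, hr⟩ := ModuleCat.exists_isRegular_of_exists_subsingleton_ext J d
      (ModuleCat.of R (R ⧸ I)) hlt (ModuleCat.of R (R ⧸ J)) hsupp hd.1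
    exact le_iSup₂_of_le rs ⟨hm, hr⟩ (by rw [hl])
end

/-! ### Monomial ideals in a restricted set of variables -/

section
open MvPolynomial

/-- `J` is generated by monomials which only involve variables indexed by `W`. -/
def IsMonomialOn {σ R : Type*} [CommRing R] (W : Set σ) (J : Ideal (MvPolynomial σ R)) : Prop :=
  ∃ s : Set (σ →₀ ℕ), (∀ e ∈ s, ∀ v ∉ W, e v = 0) ∧
    J = Ideal.span ((fun e => monomial e (1 : R)) '' s)

namespace IsMonomialOn

variable {σ R : Type*} [CommRing R] {W W' : Set σ} {J J' : Ideal (MvPolynomial σ R)}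

theorem span_X {F : Set σ} (hF : F ⊆ W) :
    IsMonomialOn W (Ideal.span (X '' F : Set (MvPolynomial σ R))) := by
  refine ⟨(fun i => Finsupp.single i 1) '' F, ?_, ?_⟩
  · rintro _ ⟨i, hi, rfl⟩ v hv
    exact Finsupp.single_eq_of_ne (fun h => hv (h ▸ hF hi))
  · rw [Set.image_image]; rfl

theorem one : IsMonomialOn W (1 : Ideal (MvPolynomial σ R)) :=
  ⟨{0}, by simp, by simp [Ideal.span_singleton_one, Ideal.one_eq_top]⟩

theorem mul (h : IsMonomialOn W J) (h' : IsMonomialOn W J') : IsMonomialOn W (J * J') := by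
  obtain ⟨s, hs, rfl⟩ := h
  obtain ⟨t, ht, rfl⟩ := h'
  refine ⟨Set.image2 (· + ·) s t, ?_, ?_⟩
  · rintro _ ⟨e, he, f, hf, rfl⟩ v hv
    simp [hs e he v hv, ht f hf v hv]
  · rw [Ideal.span_mul_span']
    congr 1
    ext p
    simp only [Set.mem_mul, Set.mem_image, Set.mem_image2]
    constructor
    · rintro ⟨_, ⟨e, he, rfl⟩, _, ⟨f, hf, rfl⟩, rfl⟩
      exact ⟨_, ⟨e, he, f, hf, rfl⟩, by simp [monomial_mul]⟩
    · rintro ⟨_, ⟨e, he, f, hf, rfl⟩, rfl⟩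
      exact ⟨_, ⟨e, he, rfl⟩, _, ⟨f, hf, rfl⟩, by simp [monomial_mul]⟩

theorem prod {ι : Type*} (s : Finset ι) (f : ι → Ideal (MvPolynomial σ R))
    (h : ∀ i ∈ s, IsMonomialOn W (f i)) : IsMonomialOn W (∏ i ∈ s, f i) :=
  Finset.prod_induction f (IsMonomialOn W) (fun _ _ => mul) one h

/-- Membership is tested monomial by monomial, and a generator free of x_a that divides x_a·m
already divides m. -/
theorem X_mul_mem (h : IsMonomialOn W J) {a : σ} (ha : a ∉ W) {u : MvPolynomial σ R}
    (hu : X a * u ∈ J) : u ∈ J := by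
  obtain ⟨s, hs, rfl⟩ := h
  rw [mem_ideal_span_monomial_image] at hu ⊢
  intro m hm
  obtain ⟨e, he, hle⟩ := hu (Finsupp.single a 1 + m) (by
    rw [mem_support_iff, coeff_X_mul]; exact mem_support_iff.1 hm)
  refine ⟨e, he, fun v => ?_⟩
  by_cases hv : v = a
  · subst hv; simp [hs e he v ha]
  · simpa [Finsupp.single_eq_of_ne hv] using hle v

theorem algHom_mem (h : IsMonomialOn W J) (f : MvPolynomial σ R →ₐ[R] MvPolynomial σ R)
    (hf : ∀ v ∈ W, f (X v) = X v) {u : MvPolynomial σ R} (hu : u ∈ J) : f u ∈ J := by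
  obtain ⟨s, hs, rfl⟩ := h
  suffices Ideal.span ((fun e => monomial e (1 : R)) '' s) ≤
      (Ideal.span ((fun e => monomial e (1 : R)) '' s)).comap f from this hu
  rw [Ideal.span_le]
  rintro _ ⟨e, he, rfl⟩
  have : f (monomial e 1) = monomial e 1 := by
    simp only [monomial_eq, map_one, one_mul, Finsupp.prod, map_prod, map_pow]
    refine Finset.prod_congr rfl fun v hv => ?_
    rw [hf v (by_contra fun hW => Finsupp.mem_support_iff.1 hv (hs e he v hW))]
  rw [SetLike.mem_coe, Ideal.mem_comap, this]
  exact Ideal.subset_span ⟨e, he, rfl⟩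

/-- The automorphism x_a ↦ x_a + x_b preserves J and turns x_a - x_b into x_a. -/
theorem X_sub_X_mul_mem (h : IsMonomialOn W J) {a b : σ} (ha : a ∉ W) (hab : a ≠ b)
    {u : MvPolynomial σ R} (hu : (X a - X b) * u ∈ J) : u ∈ J := by
  classical
  let f : MvPolynomial σ R →ₐ[R] MvPolynomial σ R :=
    aeval fun v => if v = a then X a + X b else X v
  let g : MvPolynomial σ R →ₐ[R] MvPolynomial σ R :=
    aeval fun v => if v = a then X a - X b else X v
  have hne : ∀ v ∈ W, v ≠ a := fun v hv h => ha (h ▸ hv)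
  have hgf : g.comp f = AlgHom.id R _ := by
    refine MvPolynomial.algHom_ext fun v => ?_
    by_cases hv : v = a
    · subst hv; simp [f, g, hab.symm]
    · simp [f, g, hv]
  have h1 : X a * f u ∈ J := by
    have := h.algHom_mem f (fun v hv => by simp [f, hne v hv]) hu
    simpa [f, hab.symm] using this
  have h2 := h.algHom_mem g (fun v hv => by simp [g, hne v hv]) (h.X_mul_mem ha h1)
  rwa [show g (f u) = u from DFunLike.congr_fun hgf u] at h2

/-- Two monomials in disjoint sets of variables that both divide m are coprime, so their product
divides m. -/
theorem inf_le_mul (h : IsMonomialOn W J) (h' : IsMonomialOn W' J') (hW : Disjoint W W') :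
    J ⊓ J' ≤ J * J' := by
  obtain ⟨s, hs, rfl⟩ := h
  obtain ⟨t, ht, rfl⟩ := h'
  rintro u ⟨hu, hu'⟩
  rw [SetLike.mem_coe, mem_ideal_span_monomial_image] at hu hu'
  rw [u.as_sum]
  refine Ideal.sum_mem _ fun m hm => ?_
  obtain ⟨e, he, hem⟩ := hu m hm
  obtain ⟨f, hf, hfm⟩ := hu' m hm
  have hle : e + f ≤ m := by
    intro v
    by_cases hv : v ∈ W
    · simpa [ht f hf v (Set.disjoint_left.1 hW hv)] using hem v
    · simpa [hs e he v hv] using hfm v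
  have : monomial m (coeff m u) =
      monomial (m - (e + f)) (coeff m u) * (monomial e 1 * monomial f 1) := by
    rw [monomial_mul, monomial_mul, tsub_add_cancel_of_le hle]; simp
  rw [this]
  exact Ideal.mul_mem_left _ _ (Ideal.mul_mem_mul (Ideal.subset_span ⟨e, he, rfl⟩)
    (Ideal.subset_span ⟨f, hf, rfl⟩))

theorem X_sub_X_mul_mem_mul (h : IsMonomialOn W J) (h' : IsMonomialOn W' J')
    (hW : Disjoint W W') {a b : σ} (ha : a ∉ W') (hb : b ∉ W) (hab : a ≠ b)
    {u : MvPolynomial σ R} (hu : (X a - X b) * u ∈ J * J') : u ∈ J * J' := by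
  have h1 : (X b - X a) * u ∈ J := by
    rw [← neg_sub, neg_mul]
    exact neg_mem (Ideal.mul_le_left hu)
  have h2 : (X a - X b) * u ∈ J' := Ideal.mul_le_right hu
  exact h.inf_le_mul h' hW (Submodule.mem_inf.2 ⟨h.X_sub_X_mul_mem hb hab.symm h1,
    h'.X_sub_X_mul_mem ha hab h2⟩)

end IsMonomialOn

theorem Ideal.span_X_prod_eq_inf {ι σ R : Type*} [CommRing R] (s : Finset ι) (F : ι → Finset σ)
    (hdisj : ∀ i j, i ≠ j → Disjoint (F i) (F j)) :
    ∏ i ∈ s, Ideal.span (X '' (F i : Set σ) : Set (MvPolynomial σ R)) =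
      s.inf fun i => Ideal.span (X '' (F i : Set σ)) := by
  classical
  refine le_antisymm Ideal.prod_le_inf ?_
  induction s using Finset.induction_on with
  | empty => simp
  | insert i s his ih =>
    rw [Finset.inf_insert, Finset.prod_insert his]
    refine (inf_le_inf_left _ ih).trans (IsMonomialOn.inf_le_mul (IsMonomialOn.span_X subset_rfl)
      (IsMonomialOn.prod s _ fun j hj => IsMonomialOn.span_X (W := (F i : Set σ)ᶜ) ?_)
      disjoint_compl_right)
    rw [Set.subset_compl_iff_disjoint_left, Finset.disjoint_coe]
    exact hdisj i j fun h => his (h ▸ hj)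
end

/-! ### Depth of a product of disjoint monomial primes -/

section
open MvPolynomial CategoryTheory

/-- The map that sends all elements of `A` to `b` and fixes the others. -/
def collapse {σ : Type*} [DecidableEq σ] (A : Finset σ) (b : σ) (v : σ) : σ :=
  if v ∈ A then b else v

/-- The ideal generated by the differences `X v - X b` with `v ∈ A`. -/
noncomputable def collapseIdeal (K : Type*) [Field K] {σ : Type*} (A : Finset σ) (b : σ) :
    Ideal (MvPolynomial σ K) :=
  Ideal.span ((fun v => X v - X b) '' (A : Set σ))

variable {K : Type*} [Field K]

section
variable {σ : Type*} [DecidableEq σ] {A : Finset σ} {b : σ}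

theorem collapseIdeal_insert (a : σ) : collapseIdeal K (insert a A) b =
    collapseIdeal K A b ⊔ Ideal.span {(X a - X b : MvPolynomial σ K)} := by
  rw [collapseIdeal, Finset.coe_insert, Set.image_insert_eq, Ideal.span_insert, sup_comm,
    collapseIdeal]

theorem sub_rename_collapse_mem (u : MvPolynomial σ K) :
    u - rename (collapse A b) u ∈ collapseIdeal K A b := by
  have h : (Ideal.Quotient.mkₐ K (collapseIdeal K A b)) =
      (Ideal.Quotient.mkₐ K (collapseIdeal K A b)).comp (rename (collapse A b)) := by
    refine MvPolynomial.algHom_ext fun v => ?_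
    rw [AlgHom.comp_apply, rename_X]
    by_cases hv : v ∈ A
    · simp only [collapse, hv, if_true, Ideal.Quotient.mkₐ_eq_mk]
      exact Ideal.Quotient.eq.2 (Ideal.subset_span ⟨v, hv, rfl⟩)
    · simp [collapse, hv]
  exact Ideal.Quotient.eq.1 (DFunLike.congr_fun h u)

theorem rename_collapse_eq_zero (hb : b ∉ A) {u : MvPolynomial σ K}
    (hu : u ∈ collapseIdeal K A b) : rename (collapse A b) u = 0 := by
  suffices collapseIdeal K A b ≤ RingHom.ker (rename (R := K) (collapse A b)) from this hu
  rw [collapseIdeal, Ideal.span_le]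
  rintro _ ⟨v, hv, rfl⟩
  simp [collapse, hb, Finset.mem_coe.1 hv]

/-- Working modulo the forms x_v - x_b amounts to substituting x_b for x_v, so questions about the
quotient become questions about a monomial ideal. -/
theorem mem_sup_collapseIdeal_iff (hb : b ∉ A) (I : Ideal (MvPolynomial σ K))
    (u : MvPolynomial σ K) : u ∈ I ⊔ collapseIdeal K A b ↔
      rename (collapse A b) u ∈ I.map (rename (R := K) (collapse A b)) := by
  constructor
  · intro hu
    obtain ⟨i, hi, l, hl, rfl⟩ := Submodule.mem_sup.1 hu
    rw [map_add, rename_collapse_eq_zero hb hl, add_zero]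
    exact Ideal.mem_map_of_mem _ hi
  · intro hu
    have hle : I.map (rename (R := K) (collapse A b)) ≤ I ⊔ collapseIdeal K A b := by
      rw [Ideal.map_le_iff_le_comap]
      intro i hi
      rw [Ideal.mem_comap, ← sub_sub_cancel i (rename (collapse A b) i)]
      exact sub_mem (Ideal.mem_sup_left hi) (Ideal.mem_sup_right (sub_rename_collapse_mem i))
    rw [← sub_add_cancel u (rename (collapse A b) u)]
    exact add_mem (Ideal.mem_sup_right (sub_rename_collapse_mem u)) (hle hu)

end

variable {n : ℕ} {ι : Type*} [Fintype ι]

theorem map_rename_prod_monomialPrime (c : Fin n → Fin n) (F : ι → Finset (Fin n)) :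
    (∏ j, monomialPrime K (F j)).map (rename (R := K) c) =
      ∏ j, monomialPrime K ((F j).image c) := by
  have := map_prod (Ideal.mapHom (rename (R := K) c)) (fun j => monomialPrime K (F j)) Finset.univ
  refine this.trans (Finset.prod_congr rfl fun j _ => ?_)
  change Ideal.map _ (monomialPrime K (F j)) = _
  rw [monomialPrime, Ideal.map_span, Set.image_image, monomialPrime, Finset.coe_image,
    Set.image_image]
  simp

/-- After the substitution, a factor containing x_a is unchanged and shares no variable with the
others, so the product is an intersection: x_a - x_b is regular modulo that factor because b is
absent from it, and modulo the rest because a is. If no factor contains x_a, the whole product is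
free of x_a. -/
theorem mem_of_X_sub_X_mul_mem {F : ι → Finset (Fin n)}
    (hdisj : ∀ i j, i ≠ j → Disjoint (F i) (F j)) {A : Finset (Fin n)} {a b : Fin n}
    (ha : a ∉ A) (hab : a ≠ b) (hb : b ∉ A)
    (hF : ∀ j, a ∈ F j → b ∉ F j ∧ ∀ v ∈ A, v ∉ F j) {u : MvPolynomial (Fin n) K}
    (hu : (X a - X b) * u ∈ (∏ j, monomialPrime K (F j)) ⊔ collapseIdeal K A b) :
    u ∈ (∏ j, monomialPrime K (F j)) ⊔ collapseIdeal K A b := by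
  classical
  rw [mem_sup_collapseIdeal_iff hb, map_rename_prod_monomialPrime] at hu ⊢
  have hX : rename (collapse A b) (X a - X b : MvPolynomial (Fin n) K) = X a - X b := by
    simp [collapse, ha, hb]
  rw [map_mul, hX] at hu
  generalize rename (collapse A b) u = w at hu ⊢
  have hsub : ∀ (j) (v), v ∈ (F j).image (collapse A b) → v = b ∨ v ∈ F j := by
    intro j v hv
    obtain ⟨v', hv', rfl⟩ := Finset.mem_image.1 hv
    unfold collapse
    split_ifs
    · exact .inl rfl
    · exact .inr hv'
  by_cases hex : ∃ j, a ∈ F j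
  · obtain ⟨j, hj⟩ := hex
    obtain ⟨hbj, hAj⟩ := hF j hj
    have himg : (F j).image (collapse A b) = F j := by
      refine (Finset.image_congr fun v hv => ?_).trans Finset.image_id
      exact if_neg fun h => hAj v h hv
    rw [← Finset.mul_prod_erase _ _ (Finset.mem_univ j), himg] at hu ⊢
    have hM : IsMonomialOn ((F j : Set (Fin n))ᶜ)
        (∏ i ∈ Finset.univ.erase j, monomialPrime K ((F i).image (collapse A b))) := by
      refine IsMonomialOn.prod _ _ fun i hi => IsMonomialOn.span_X fun v hv hvj => ?_
      obtain rfl | h := hsub i v hv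
      · exact hbj hvj
      · exact Finset.disjoint_left.1 (hdisj i j (Finset.ne_of_mem_erase hi)) h hvj
    have hP : IsMonomialOn (F j : Set (Fin n)) (monomialPrime K (F j)) :=
      IsMonomialOn.span_X subset_rfl
    exact hP.X_sub_X_mul_mem_mul hM disjoint_compl_right (fun h => h hj) hbj hab hu
  · push Not at hex
    have hM : IsMonomialOn ({a}ᶜ : Set (Fin n))
        (∏ i, monomialPrime K ((F i).image (collapse A b))) := by
      refine IsMonomialOn.prod _ _ fun i _ => IsMonomialOn.span_X fun v hv hva => ?_
      obtain rfl | h := hsub i v hv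
      · exact hab hva.symm
      · exact hex i (hva ▸ h)
    exact hM.X_sub_X_mul_mem (fun h => h rfl) hab hu

theorem pow_X_notMem_prod_monomialPrime (b : Fin n) (G : ι → Finset (Fin n)) {k : ℕ}
    (hk : k < Fintype.card ι) :
    (X b ^ k : MvPolynomial (Fin n) K) ∉ ∏ j, monomialPrime K (G j) := by
  intro h
  have hle : ∏ j, monomialPrime K (G j) ≤ idealOfVars (Fin n) K ^ Fintype.card ι := by
    rw [← Finset.card_univ, ← Finset.prod_const]
    exact Finset.prod_le_prod' fun j _ => Ideal.span_mono (Set.image_subset_range _ _)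
  have := hle h
  rw [X_pow_eq_monomial, monomial_mem_pow_idealOfVars_iff _ _ one_ne_zero] at this
  simp at this
  omega

/-- After the substitution each variable lies in some factor; x_b can be taken from each of the
remaining ones. -/
theorem socle_collapse [Nonempty ι] {F : ι → Finset (Fin n)} {C : Finset (Fin n)} {b : Fin n}
    (hb : b ∉ C) (hmeet : ∀ j, ∃ v ∈ F j, v ∈ C ∨ v = b)
    (hcover : ∀ v, v ∈ C ∨ v = b ∨ ∃ j, v ∈ F j) {x : MvPolynomial (Fin n) K}
    (hx : x ∈ idealOfVars (Fin n) K) :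
    x * X b ^ (Fintype.card ι - 1) ∈ (∏ j, monomialPrime K (F j)) ⊔ collapseIdeal K C b := by
  classical
  rw [mul_comm]
  revert x
  change idealOfVars (Fin n) K ≤ Submodule.comap (LinearMap.mulLeft (MvPolynomial (Fin n) K)
    (X b ^ (Fintype.card ι - 1))) ((∏ j, monomialPrime K (F j)) ⊔ collapseIdeal K C b)
  rw [idealOfVars, Ideal.span_le]
  rintro _ ⟨v, rfl⟩
  change X b ^ (Fintype.card ι - 1) * X v ∈
    (∏ j, monomialPrime K (F j)) ⊔ collapseIdeal K C b
  rw [mem_sup_collapseIdeal_iff hb, map_rename_prod_monomialPrime, map_mul, map_pow, rename_X,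
    rename_X]
  have hbb : collapse C b b = b := if_neg hb
  rw [hbb]
  have hbj : ∀ j, b ∈ (F j).image (collapse C b) := by
    intro j
    obtain ⟨w, hw, h⟩ := hmeet j
    refine Finset.mem_image.2 ⟨w, hw, ?_⟩
    obtain h | rfl := h
    · exact if_pos h
    · exact hbb
  have hv : ∃ j, collapse C b v ∈ (F j).image (collapse C b) := by
    obtain h | rfl | ⟨j, hj⟩ := hcover v
    · obtain ⟨j⟩ := ‹Nonempty ι›
      exact ⟨j, by rw [show collapse C b v = b from if_pos h]; exact hbj j⟩
    · obtain ⟨j⟩ := ‹Nonempty ι›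
      exact ⟨j, by rw [hbb]; exact hbj j⟩
    · exact ⟨j, Finset.mem_image_of_mem _ hj⟩
  obtain ⟨j, hj⟩ := hv
  rw [← Finset.prod_erase_mul _ _ (Finset.mem_univ j)]
  refine Ideal.mul_mem_mul ?_ (Ideal.subset_span ⟨_, hj, rfl⟩)
  rw [← Finset.card_univ, ← Finset.card_erase_of_mem (Finset.mem_univ j), ← Finset.prod_const]
  exact Ideal.prod_mem_prod fun i _ => Ideal.subset_span ⟨_, hbj i, rfl⟩

/-- The hypotheses say that each F_j meets C ∪ {b} in exactly one element, and that the F_j together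
with C ∪ {b} cover all indices. -/
theorem moduleDepth_quotient_prod_monomialPrime [Nonempty ι] {F : ι → Finset (Fin n)}
    (hdisj : ∀ i j, i ≠ j → Disjoint (F i) (F j)) {C : Finset (Fin n)} {b : Fin n}
    (hb : b ∉ C) (hmeet : ∀ j, ∃ v ∈ F j, v ∈ C ∨ v = b)
    (huniq : ∀ j, ∀ a ∈ F j, a ∈ C → b ∉ F j ∧ ∀ v ∈ F j, v ∈ C → v = a)
    (hcover : ∀ v, v ∈ C ∨ v = b ∨ ∃ j, v ∈ F j) :
    moduleDepth (idealOfVars (Fin n) K)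
      (MvPolynomial (Fin n) K ⧸ ∏ j, monomialPrime K (F j)) = C.card := by
  classical
  -- The induction starts from the fully collapsed quotient, of depth 0, and undoes one form x_a -
  -- x_b at a time.
  have hchain : ∀ A ⊆ C, FirstNonzeroExt
      (ModuleCat.of (MvPolynomial (Fin n) K) (MvPolynomial (Fin n) K ⧸ idealOfVars (Fin n) K))
      (ModuleCat.of (MvPolynomial (Fin n) K) (MvPolynomial (Fin n) K ⧸
        ((∏ j, monomialPrime K (F j)) ⊔ collapseIdeal K (C \ A) b))) A.card := by
    intro A
    induction A using Finset.induction_on with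
    | empty =>
      intro _
      rw [Finset.sdiff_empty, Finset.card_empty]
      refine firstNonzeroExt_zero_of_socle ?_ fun x hx => socle_collapse hb hmeet hcover hx
      rw [mem_sup_collapseIdeal_iff hb, map_rename_prod_monomialPrime, map_pow, rename_X]
      exact pow_X_notMem_prod_monomialPrime _ _ (Nat.sub_lt Fintype.card_pos one_pos)
    | insert a A ha ih =>
      intro hA
      have haC : a ∈ C := hA (Finset.mem_insert_self _ _)
      have hins : C \ A = insert a (C \ insert a A) := by
        ext v; simp only [Finset.mem_sdiff, Finset.mem_insert]
        by_cases hv : v = a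
        · subst hv; simp [haC, ha]
        · simp [hv]
      have ih' := ih ((Finset.subset_insert _ _).trans hA)
      rw [hins, collapseIdeal_insert, ← sup_assoc] at ih'
      rw [Finset.card_insert_of_notMem ha]
      refine firstNonzeroExt_quotient_succ (h := X a - X b) ?_ (fun u hu => ?_) ih'
      · exact sub_mem (Ideal.subset_span ⟨a, rfl⟩) (Ideal.subset_span ⟨b, rfl⟩)
      · refine mem_of_X_sub_X_mul_mem hdisj (by simp) (by rintro rfl; exact hb haC) (by simp [hb]) ?_ hu
        intro j haj
        obtain ⟨h1, h2⟩ := huniq j a haj haC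
        refine ⟨h1, fun v hv hvj => ?_⟩
        rw [Finset.mem_sdiff] at hv
        exact hv.2 (h2 v hvj hv.1 ▸ Finset.mem_insert_self _ _)
  have hmain := hchain C subset_rfl
  rw [Finset.sdiff_self] at hmain
  have hbot : collapseIdeal K (∅ : Finset (Fin n)) b = ⊥ := by simp [collapseIdeal]
  rw [hbot, sup_bot_eq] at hmain
  refine moduleDepth_quotient_eq ?_ ?_ hmain
  · obtain ⟨j⟩ := ‹Nonempty ι›
    exact (Ideal.prod_le_inf.trans (Finset.inf_le (Finset.mem_univ j))).trans
      (Ideal.span_mono (Set.image_subset_range _ _))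
  · intro h
    have : (1 : MvPolynomial (Fin n) K) ∈ idealOfVars (Fin n) K ^ 1 := by rw [pow_one, h]; trivial
    rw [← C_1, C_mem_pow_idealOfVars_iff] at this
    simp at this
end

/-! ### Associated primes, mdepth and the numerical criterion -/

section
open MvPolynomial

variable {K : Type*} [Field K] {n : ℕ}

theorem X_mem_monomialPrime {F : Finset (Fin n)} {v : Fin n} :
    (X v : MvPolynomial (Fin n) K) ∈ monomialPrime K F ↔ v ∈ F := by
  classical
  rw [monomialPrime, mem_ideal_span_X_image]
  simp [support_X, Finsupp.single_apply]

theorem monomialPrime_le_iff {F G : Finset (Fin n)} :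
    monomialPrime K F ≤ monomialPrime K G ↔ F ⊆ G :=
  ⟨fun h _ hv => X_mem_monomialPrime.1 (h (X_mem_monomialPrime.2 hv)),
    fun h => Ideal.span_mono (Set.image_mono h)⟩

theorem ker_killCompl_eq_monomialPrime (F : Finset (Fin n)) :
    RingHom.ker (killCompl (R := K) (Subtype.val_injective (p := fun v => v ∉ F))) =
      monomialPrime K F := by
  set κ := killCompl (R := K) (Subtype.val_injective (p := fun v => v ∉ F)) with hκ
  have hX : ∀ v ∈ F, κ (X v) = 0 := by
    intro v hv
    simp only [hκ, killCompl, aeval_X]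
    exact dif_neg (by simpa using hv)
  have hX' : ∀ v (h : v ∉ F), κ (X v) = X ⟨v, h⟩ := by
    intro v h
    have := killCompl_rename_app (R := K) (Subtype.val_injective (p := fun v => v ∉ F)) (X ⟨v, h⟩)
    rwa [rename_X] at this
  apply le_antisymm
  · intro u hu
    have h : (Ideal.Quotient.mkₐ K (monomialPrime K F)) =
        ((Ideal.Quotient.mkₐ K (monomialPrime K F)).comp (rename Subtype.val)).comp κ := by
      refine MvPolynomial.algHom_ext fun v => ?_
      by_cases hv : v ∈ F
      · rw [AlgHom.comp_apply, hX v hv, map_zero, Ideal.Quotient.mkₐ_eq_mk]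
        exact Ideal.Quotient.eq_zero_iff_mem.2 (X_mem_monomialPrime.2 hv)
      · rw [AlgHom.comp_apply, hX' v hv, AlgHom.comp_apply, rename_X]
    have h' := DFunLike.congr_fun h u
    rw [AlgHom.comp_apply, RingHom.mem_ker.1 hu, map_zero] at h'
    exact Ideal.Quotient.eq_zero_iff_mem.1 h'
  · rw [monomialPrime, Ideal.span_le]
    rintro _ ⟨v, hv, rfl⟩
    exact hX v hv

instance monomialPrime_isPrime (F : Finset (Fin n)) : (monomialPrime K F).IsPrime := by
  rw [← ker_killCompl_eq_monomialPrime]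
  exact RingHom.ker_isPrime _

theorem ringKrullDim_quotient_monomialPrime (F : Finset (Fin n)) :
    ringKrullDim (MvPolynomial (Fin n) K ⧸ monomialPrime K F) = ((n - F.card : ℕ) : ℕ∞) := by
  have hsurj : Function.Surjective
      (killCompl (R := K) (Subtype.val_injective (p := fun v => v ∉ F))) :=
    fun p => ⟨_, killCompl_rename_app _ p⟩
  rw [← ker_killCompl_eq_monomialPrime,
    ringKrullDim_eq_of_ringEquiv (Ideal.quotientKerAlgEquivOfSurjective hsurj).toRingEquiv,
    MvPolynomial.ringKrullDim_of_isNoetherianRing, ringKrullDim_eq_zero_of_field, zero_add,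
    Nat.card_eq_fintype_card]
  have hcard : Fintype.card {v // v ∉ F} = n - F.card := by
    rw [Fintype.card_subtype_compl, Fintype.card_fin, Fintype.card_coe]
  rw [hcard]
  rfl

/-- A generator divides the irreducible x_a without being a unit, so it is associated to x_a, and
x_a then divides every x_b with b ∈ G. -/
theorem isPrincipal_monomialPrime_iff {G : Finset (Fin n)} (hG : G.Nonempty) :
    (monomialPrime K G).IsPrincipal ↔ G.card = 1 := by
  constructor
  · rintro ⟨g, hg⟩
    change monomialPrime K G = Ideal.span {g} at hg
    obtain ⟨a, ha⟩ := hG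
    refine Finset.card_eq_one.2 ⟨a, Finset.eq_singleton_iff_unique_mem.2 ⟨ha, fun b hb => ?_⟩⟩
    have hdvd : ∀ v ∈ G, g ∣ X v := fun v hv =>
      Ideal.mem_span_singleton.1 (hg ▸ X_mem_monomialPrime.2 hv)
    have hprime : Prime (X a : MvPolynomial (Fin n) K) := by
      rw [← Ideal.span_singleton_prime (X_ne_zero a)]
      simpa [monomialPrime] using monomialPrime_isPrime (K := K) {a}
    rcases (hprime.irreducible.dvd_iff (y := g)).1 (hdvd a ha) with h | h
    · refine absurd (monomialPrime_isPrime (K := K) G).ne_top ?_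
      rw [not_not, hg, Ideal.span_singleton_eq_top]
      exact h
    · exact (X_dvd_X.1 (h.dvd.trans (hdvd b hb))).symm
  · intro h
    obtain ⟨a, rfl⟩ := Finset.card_eq_one.1 h
    exact ⟨X a, by simp [monomialPrime, Ideal.submodule_span_eq]⟩

variable {ι : Type*} [Fintype ι]

theorem mem_associatedPrimes_iInf_monomialPrime {F : ι → Finset (Fin n)}
    (hF : ∀ i, (F i).Nonempty) (hdisj : ∀ i j, i ≠ j → Disjoint (F i) (F j))
    (p : Ideal (MvPolynomial (Fin n) K)) :
    p ∈ associatedPrimes (MvPolynomial (Fin n) K)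
      (MvPolynomial (Fin n) K ⧸ ⨅ i, monomialPrime K (F i)) ↔
      ∃ i, p = monomialPrime K (F i) := by
  classical
  have hcolon : ∀ u x : MvPolynomial (Fin n) K, x ∈ Submodule.colon
      (⊥ : Submodule (MvPolynomial (Fin n) K)
        (MvPolynomial (Fin n) K ⧸ ⨅ i, monomialPrime K (F i))) {Submodule.Quotient.mk u} ↔
      ∀ i, x * u ∈ monomialPrime K (F i) := by
    intro u x
    rw [Submodule.mem_colon_singleton, ← Submodule.Quotient.mk_smul, Submodule.mem_bot,
      Submodule.Quotient.mk_eq_zero, Submodule.mem_iInf]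
    rfl
  rw [AssociatedPrimes.mem_iff, isAssociatedPrime_iff]
  constructor
  · rintro ⟨hp, x, hx⟩
    obtain ⟨u, rfl⟩ := Submodule.Quotient.mk_surjective _ x
    -- The annihilator of the class of u contains the intersection of those p_{F_i} that omit u;
    -- being prime, it contains one of them.
    have hle : (Finset.univ.filter fun i => u ∉ monomialPrime K (F i)).inf
        (fun i => monomialPrime K (F i)) ≤ p := by
      intro y hy
      rw [hx, hcolon]
      intro i
      by_cases hu : u ∈ monomialPrime K (F i)
      · exact Ideal.mul_mem_left _ _ hu
      · exact Ideal.mul_mem_right _ _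
          ((Finset.inf_le (f := fun i => monomialPrime K (F i)) (by simpa using hu) : _ ≤ _) hy)
    obtain ⟨i, hi, hip⟩ := hp.inf_le'.1 hle
    refine ⟨i, le_antisymm (fun y hy => ?_) hip⟩
    rw [hx, hcolon] at hy
    exact ((monomialPrime_isPrime (F i)).mem_or_mem (hy i)).resolve_right (by simpa using hi)
  · rintro ⟨i, rfl⟩
    choose z hz using hF
    -- This product lies in every p_{F_j} with j ≠ i but, by disjointness, not in p_{F_i}.
    refine ⟨inferInstance, Submodule.Quotient.mk (∏ j ∈ Finset.univ.erase i, X (z j)), ?_⟩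
    ext x
    rw [hcolon]
    constructor
    · intro hx j
      by_cases hj : j = i
      · subst hj; exact Ideal.mul_mem_right _ _ hx
      · refine Ideal.mul_mem_left _ _ (Ideal.mem_of_dvd _ (Finset.dvd_prod_of_mem _
          (Finset.mem_erase.2 ⟨hj, Finset.mem_univ j⟩)) (X_mem_monomialPrime.2 (hz j)))
    · intro hx
      refine ((monomialPrime_isPrime (F i)).mem_or_mem (hx i)).resolve_right fun h => ?_
      obtain ⟨j, hj, h⟩ := (monomialPrime_isPrime (F i)).prod_mem_iff.1 h
      exact Finset.disjoint_left.1 (hdisj j i (Finset.ne_of_mem_erase hj)) (hz j)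
        (X_mem_monomialPrime.1 h)

theorem moduleMDepth_quotient_iInf_monomialPrime {F : ι → Finset (Fin n)}
    (hF : ∀ i, (F i).Nonempty) (hdisj : ∀ i j, i ≠ j → Disjoint (F i) (F j))
    {i : ι} (hi : ∀ j, (F j).card ≤ (F i).card) :
    moduleMDepth (MvPolynomial (Fin n) K)
      (MvPolynomial (Fin n) K ⧸ ⨅ i, monomialPrime K (F i)) = ((n - (F i).card : ℕ) : ℕ∞) := by
  apply le_antisymm
  · rw [← ringKrullDim_quotient_monomialPrime (K := K)]
    exact iInf₂_le _ ((mem_associatedPrimes_iInf_monomialPrime hF hdisj _).2 ⟨i, rfl⟩)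
  · refine le_iInf₂ fun p hp => ?_
    obtain ⟨j, rfl⟩ := (mem_associatedPrimes_iInf_monomialPrime hF hdisj p).1 hp
    rw [ringKrullDim_quotient_monomialPrime]
    exact_mod_cast Nat.sub_le_sub_left (hi j) n

theorem prod_monomialPrime_eq_iInf {F : ι → Finset (Fin n)}
    (hdisj : ∀ i j, i ≠ j → Disjoint (F i) (F j)) :
    ∏ i, monomialPrime K (F i) = ⨅ i, monomialPrime K (F i) := by
  rw [← Finset.inf_univ_eq_iInf]
  exact Ideal.span_X_prod_eq_inf Finset.univ F hdisj

theorem exists_moduleDepth_quotient_iInf_monomialPrime [Nonempty ι] {F : ι → Finset (Fin n)}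
    (hF : ∀ i, (F i).Nonempty) (hdisj : ∀ i j, i ≠ j → Disjoint (F i) (F j)) :
    ∃ d : ℕ, d + 1 + ∑ i, ((F i).card - 1) = n ∧
      moduleDepth (idealOfVars (Fin n) K)
        (MvPolynomial (Fin n) K ⧸ ⨅ i, monomialPrime K (F i)) = d := by
  classical
  choose z hz using hF
  obtain ⟨j₀⟩ := ‹Nonempty ι›
  -- Besides x_b, these are the variables that survive the collapse; C is the complement of U
  -- without b = z j₀.
  set U : Finset (Fin n) := Finset.univ.biUnion fun i => (F i).erase (z i) with hU
  have hmemU : ∀ {i v}, v ∈ F i → v ∉ U → v = z i := by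
    intro i v hv hvU
    by_contra hne
    exact hvU (Finset.mem_biUnion.2 ⟨i, Finset.mem_univ i, Finset.mem_erase.2 ⟨hne, hv⟩⟩)
  have hzU : ∀ i, z i ∉ U := by
    intro i h
    obtain ⟨j, -, hj⟩ := Finset.mem_biUnion.1 h
    obtain ⟨hne, hij⟩ := Finset.mem_erase.1 hj
    by_cases hji : j = i
    · subst hji; exact hne rfl
    · exact Finset.disjoint_left.1 (hdisj j i hji) hij (hz i)
  have hcardU : U.card = ∑ i, ((F i).card - 1) := by
    rw [hU, Finset.card_biUnion]
    · exact Finset.sum_congr rfl fun i _ => Finset.card_erase_of_mem (hz i)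
    · intro i _ j _ hij
      exact (hdisj i j hij).mono (Finset.erase_subset _ _) (Finset.erase_subset _ _)
  have hmemC : ∀ {v}, v ∈ Uᶜ.erase (z j₀) ↔ v ≠ z j₀ ∧ v ∉ U := by simp
  refine ⟨(Uᶜ.erase (z j₀)).card, ?_, ?_⟩
  · rw [Finset.card_erase_add_one (by simpa using hzU j₀), ← hcardU, Finset.card_compl_add_card,
      Fintype.card_fin]
  · have : Nonempty ι := ⟨j₀⟩
    rw [← prod_monomialPrime_eq_iInf hdisj]
    refine moduleDepth_quotient_prod_monomialPrime (b := z j₀) hdisj (by simp)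
      (fun j => ⟨z j, hz j, ?_⟩) (fun j a ha haC => ?_) (fun v => ?_)
    · by_cases h : z j = z j₀
      · exact .inr h
      · exact .inl (hmemC.2 ⟨h, hzU j⟩)
    · obtain ⟨hne, haU⟩ := hmemC.1 haC
      have haz := hmemU ha haU
      refine ⟨fun hb => hne ?_, fun v hv hvC => ?_⟩
      · rw [haz, hmemU hb (hzU j₀)]
      · rw [haz, hmemU hv (hmemC.1 hvC).2]
    · by_cases hv : v = z j₀
      · exact .inr (.inl hv)
      · by_cases hvU : v ∈ U
        · obtain ⟨j, -, hj⟩ := Finset.mem_biUnion.1 hvU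
          exact .inr (.inr ⟨j, Finset.mem_of_mem_erase hj⟩)
        · exact .inl (hmemC.2 ⟨hv, hvU⟩)

theorem hasMaximalDepth_iInf_monomialPrime_iff [Nonempty ι] {F : ι → Finset (Fin n)}
    (hF : ∀ i, (F i).Nonempty) (hdisj : ∀ i j, i ≠ j → Disjoint (F i) (F j)) :
    HasMaximalDepth (⨅ i, monomialPrime K (F i)) ↔
      ∀ i j, (F i).card ≠ 1 → (F j).card ≠ 1 → i = j := by
  classical
  obtain ⟨d, hd, hdepth⟩ := exists_moduleDepth_quotient_iInf_monomialPrime (K := K) hF hdisj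
  obtain ⟨i₀, hi₀⟩ := Finite.exists_max fun i => (F i).card
  have hpos : ∀ i, 1 ≤ (F i).card := fun i => (hF i).card_pos
  have hle : (F i₀).card ≤ n := (Finset.card_le_univ _).trans_eq (Fintype.card_fin n)
  rw [HasMaximalDepth, hdepth, moduleMDepth_quotient_iInf_monomialPrime hF hdisj hi₀]
  have hsum := Finset.add_sum_erase Finset.univ (fun i => (F i).card - 1) (Finset.mem_univ i₀)
  -- The maximal set F i₀ contributes |F i₀| - 1 to the depth formula, so equality leaves nothing
  -- for the other sets.
  have h1 : (((d : ℕ∞) : WithBot ℕ∞) = ((n - (F i₀).card : ℕ) : ℕ∞)) ↔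
      ∑ i ∈ Finset.univ.erase i₀, ((F i).card - 1) = 0 := by
    have := hpos i₀
    norm_cast
    omega
  rw [h1, Finset.sum_eq_zero_iff]
  constructor
  · intro h
    have : ∀ i, (F i).card ≠ 1 → i = i₀ := by
      intro i hi
      by_contra hne
      have := h i (by simpa using hne)
      have := hpos i
      omega
    intro i j hi hj
    rw [this i hi, this j hj]
  · intro h i hi
    have := hpos i
    have := hi₀ i
    by_contra hne
    exact Finset.ne_of_mem_erase hi (h i i₀ (by omega) (by omega))
end

/-! ### Comparison with arbitrary factorisations -/

theorem mainTheorem9 {K : Type*} [Field K] (n r : ℕ) (hr : 1 ≤ r)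
    (F : Fin r → Finset (Fin n)) (hF : ∀ i, (F i).Nonempty)
    (hdisj : ∀ i j, i ≠ j → Disjoint (F i) (F j))
    (I : Ideal (MvPolynomial (Fin n) K)) (hI : I = ⨅ i, monomialPrime K (F i)) :
    HasMaximalDepth I ↔
      ∃ s : ℕ, 1 ≤ s ∧ ∃ G : Fin s → Finset (Fin n),
        (∀ j, (G j).Nonempty) ∧
        I = ∏ j, monomialPrime K (G j) ∧
        ∀ j k, ¬ (monomialPrime K (G j)).IsPrincipal →
          ¬ (monomialPrime K (G k)).IsPrincipal → j = k := by
  have : Nonempty (Fin r) := ⟨⟨0, hr⟩⟩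
  rw [hI, hasMaximalDepth_iInf_monomialPrime_iff hF hdisj]
  constructor
  · intro h
    refine ⟨r, hr, F, hF, (prod_monomialPrime_eq_iInf hdisj).symm, fun j k hj hk => ?_⟩
    rw [isPrincipal_monomialPrime_iff (hF _)] at hj hk
    exact h j k hj hk
  · rintro ⟨s, -, G, hG, hprod, huniq⟩
    -- Primality gives F k ⊆ G j ⊆ F i for some j and k, and disjointness forces k = i.
    have hfactor : ∀ i, ∃ j, G j = F i := by
      intro i
      have hle : ∏ j, monomialPrime K (G j) ≤ monomialPrime K (F i) := hprod ▸ iInf_le _ i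
      obtain ⟨j, -, hj⟩ := (monomialPrime_isPrime (F i)).prod_le.1 hle
      have hle' : Finset.univ.inf (fun k => monomialPrime K (F k)) ≤ monomialPrime K (G j) := by
        rw [Finset.inf_univ_eq_iInf, hprod]
        exact Ideal.prod_le_inf.trans (Finset.inf_le (Finset.mem_univ j))
      obtain ⟨k, -, hk⟩ := (monomialPrime_isPrime (G j)).inf_le'.1 hle'
      rw [monomialPrime_le_iff] at hj hk
      have hki : k = i := by
        by_contra hne
        obtain ⟨v, hv⟩ := hF k
        exact Finset.disjoint_left.1 (hdisj k i hne) hv (hj (hk hv))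
      subst hki
      exact ⟨j, hj.antisymm hk⟩
    intro i i' hi hi'
    obtain ⟨j, hj⟩ := hfactor i
    obtain ⟨j', hj'⟩ := hfactor i'
    have hjj : j = j' := by
      refine huniq j j' ?_ ?_ <;> rw [isPrincipal_monomialPrime_iff (hG _)]
      · rwa [hj]
      · rwa [hj']
    by_contra hne
    obtain ⟨v, hv⟩ := hF i
    have hv' : v ∈ F i' := by rw [← hj', ← hjj, hj]; exact hv
    exact Finset.disjoint_left.1 (hdisj i i' hne) hv hv'
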